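/- Directed graphs may be finite or infinite and may have parallel edges and loops. An edge $e$ from $u$ to $v\neq u$ of a directed graph is butterfly contractible if $e$ is the only outgoing edge of $u$ or the only incoming edge of $v$. A directed graph $H$ is a butterfly minor of a directed graph $D$ if $H$ can be obtained, up to isomorphism, from a subgraph of $D$ by repeatedly (finitely often) contracting butterfly contractible edges. Contracting an edge removes it and merges its two ends, and every other edge is kept. For an undirected graph $G$, let $\mathcal D(G)$ be the directed graph obtained from $G$ by replacing each edge $uv$ by the two directed edges $(u,v)$ and $(v,u)$. Let $K_{1,n}$ be the star with $n$ leaves and $P_n$ the path with $n$ edges. Statement. There is a function $g:\mathbb N\to\mathbb N$ such that, for every $n\in\mathbb N$ (including $n = 0$), every strongly connected directed graph $D$ with at least $g(n)$ vertices contains $\mathcal D(K_{1,n})$, $\mathcal D(P_n)$ or (if $n\ge 1$) a directed cycle of length $n$ as a butterfly minor. -/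

import Mathlib

/-- A directed graph, finite or infinite, with parallel edges and loops allowed. Its vertices and its
edges are taken from the types `V` and `E`; the values of `tail` and `head` off `edges` are
irrelevant. -/
structure MultiDigraph (V : Type*) (E : Type*) where
  verts : Set V
  edges : Set E
  tail : E → V
  head : E → V
  tail_mem : ∀ e ∈ edges, tail e ∈ verts
  head_mem : ∀ e ∈ edges, head e ∈ verts

namespace MultiDigraph

/-- There is an edge from `u` to `v`. -/
def Adj {V E : Type*} (D : MultiDigraph V E) (u v : V) : Prop :=
  ∃ e ∈ D.edges, D.tail e = u ∧ D.head e = v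

/-- From every vertex one can reach every vertex along directed edges. -/
def StronglyConnected {V E : Type*} (D : MultiDigraph V E) : Prop :=
  ∀ u ∈ D.verts, ∀ v ∈ D.verts, Relation.ReflTransGen D.Adj u v

/-- `H` is a (not necessarily induced or spanning) subgraph of `D`. -/
structure IsSubgraph {V E : Type*} (H D : MultiDigraph V E) : Prop where
  verts_subset : H.verts ⊆ D.verts
  edges_subset : H.edges ⊆ D.edges
  tail_eq : ∀ e ∈ H.edges, H.tail e = D.tail e
  head_eq : ∀ e ∈ H.edges, H.head e = D.head e

/-- The edge `e` is not a loop, and it is the only outgoing edge of its tail or the only incoming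
edge of its head. -/
structure ButterflyContractible {V E : Type*} (D : MultiDigraph V E) (e : E) : Prop where
  mem : e ∈ D.edges
  tail_ne_head : D.tail e ≠ D.head e
  unique : (∀ f ∈ D.edges, D.tail f = D.tail e → f = e) ∨
    (∀ f ∈ D.edges, D.head f = D.head e → f = e)

open Classical in
/-- The vertex to which `x` is sent when the edge `e` is contracted: the two ends of `e` are merged,
and the merged vertex is called `D.tail e`. -/
noncomputable def mergeEnds {V E : Type*} (D : MultiDigraph V E) (e : E) (x : V) : V :=
  if x = D.head e then D.tail e else x

theorem mergeEnds_mem {V E : Type*} (D : MultiDigraph V E) {e : E} (he : e ∈ D.edges)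
    (hne : D.tail e ≠ D.head e) {x : V} (hx : x ∈ D.verts) :
    D.mergeEnds e x ∈ D.verts \ {D.head e} := by
  unfold mergeEnds
  split_ifs with h
  · exact ⟨D.tail_mem e he, hne⟩
  · exact ⟨hx, h⟩

/-- The digraph obtained by contracting the non-loop edge `e`: the edge `e` is removed, its two ends
are merged, and every other edge keeps its (merged) ends. -/
noncomputable def contract {V E : Type*} (D : MultiDigraph V E) (e : E) (he : e ∈ D.edges)
    (hne : D.tail e ≠ D.head e) : MultiDigraph V E where
  verts := D.verts \ {D.head e}
  edges := D.edges \ {e}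
  tail f := D.mergeEnds e (D.tail f)
  head f := D.mergeEnds e (D.head f)
  tail_mem f hf := D.mergeEnds_mem he hne (D.tail_mem f hf.1)
  head_mem f hf := D.mergeEnds_mem he hne (D.head_mem f hf.1)

/-- `D'` arises from `D` by contracting one butterfly contractible edge. -/
def ButterflyStep {V E : Type*} (D D' : MultiDigraph V E) : Prop :=
  ∃ (e : E) (h : D.ButterflyContractible e), D' = D.contract e h.mem h.tail_ne_head

/-- Isomorphism of directed graphs. -/
structure Iso {V E W F : Type*} (H : MultiDigraph V E) (D : MultiDigraph W F) where
  onVerts : H.verts ≃ D.verts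
  onEdges : H.edges ≃ D.edges
  tail_eq : ∀ e : H.edges, D.tail (onEdges e) = onVerts ⟨H.tail e, H.tail_mem e e.2⟩
  head_eq : ∀ e : H.edges, D.head (onEdges e) = onVerts ⟨H.head e, H.head_mem e e.2⟩

/-- `H` is, up to isomorphism, obtained from a subgraph of `D` by repeatedly (finitely often)
contracting butterfly contractible edges. -/
def IsButterflyMinor {V E W F : Type*} (H : MultiDigraph V E) (D : MultiDigraph W F) : Prop :=
  ∃ S M : MultiDigraph W F, S.IsSubgraph D ∧ Relation.ReflTransGen ButterflyStep S M ∧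
    Nonempty (H.Iso M)

/-- The digraph obtained from an undirected graph by replacing each edge `uv` by the two directed
edges `(u, v)` and `(v, u)`. -/
def ofSimpleGraph {V : Type*} (G : SimpleGraph V) : MultiDigraph V G.Dart where
  verts := Set.univ
  edges := Set.univ
  tail d := d.fst
  head d := d.snd
  tail_mem _ _ := Set.mem_univ _
  head_mem _ _ := Set.mem_univ _

/-- The directed cycle `0 → 1 → ⋯ → n - 1 → 0` of length `n`, for `n ≥ 1`; a loop if `n = 1`. -/
def directedCycle (n : ℕ) : MultiDigraph (Fin n) (Fin n) where
  verts := Set.univ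
  edges := Set.univ
  tail i := i
  head i := finRotate n i
  tail_mem _ _ := Set.mem_univ _
  head_mem _ _ := Set.mem_univ _

end MultiDigraph

/-! Fix n ≥ 1. A directed cycle of length at least n contracts to one of length n, so assume there
is none. The remaining dichotomy is whether D has a directed path with L = n² edges.

Without such a path, breadth-first trees have depth at most L. An out-tree on many vertices has a
vertex r with many children. In an in-tree towards r, the walks from these children merge, and since
the depth is bounded some w has n children c_i, other than w, on these walks. The part of the walks
up to c_i is the i-th leaf; the rest, containing w and r, is the centre, with edges from r into each
leaf and from each c_i to w.

With such a path x 0, …, x L, follow from x L a cheapest walk back to x 0, where path edges cost 1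
and all others L + 1. The walk moves forward only along the path. Order its leaving points by index.
Each return from a leaving point other than x 0 lands in the path segment ending at the preceding
one. Cutting the path after each leaving point therefore gives consecutive segments joined in both
directions. A return spanning n or more path edges would close a long cycle, so there are at least n
+ 1 leaving points.

In all three cases the branch sets are in-trees and every edge between them starts at a root
(`isButterflyMinor_of_inTrees`). The tree edges are then the only outgoing edges of their tails, and
contracting one of them keeps this true of the others. -/

namespace MultiDigraph

variable {V E W F : Type*}

/-! ### Contracting in-trees -/

-- The edges of `T` form a forest, because `h` drops along each of them and each is the only edge
-- leaving its tail. Every tree has exactly one vertex that is not a tail, its root, so `ψ`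
-- restricted to roots names the contracted vertices. The induction contracts one edge at a time and
-- leaves `ψ` and `ε` unchanged.
open Classical in
theorem exists_contraction_iso {H : MultiDigraph W F} {ψ : V → W} {ε : F → E} (T : Finset E) :
    ∀ (S : MultiDigraph V E) (h : V → ℕ), ↑T ⊆ S.edges →
      (∀ e ∈ T, ∀ f ∈ S.edges, S.tail f = S.tail e → f = e) →
      (∀ e ∈ T, h (S.head e) < h (S.tail e)) →
      (∀ e ∈ T, ψ (S.tail e) = ψ (S.head e)) →
      Set.BijOn ψ {x ∈ S.verts | ∀ e ∈ T, S.tail e ≠ x} H.verts →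
      Set.BijOn ε H.edges (S.edges \ T) →
      (∀ f ∈ H.edges, ψ (S.tail (ε f)) = H.tail f) →
      (∀ f ∈ H.edges, ψ (S.head (ε f)) = H.head f) →
      ∃ M, Relation.ReflTransGen ButterflyStep S M ∧ Nonempty (H.Iso M) := by
  induction T using Finset.induction_on with
  | empty =>
    intro S h _ _ _ _ hv he ht hh
    have hv' : Set.BijOn ψ S.verts H.verts := by simpa using hv
    have he' : Set.BijOn ε H.edges S.edges := by simpa using he
    refine ⟨S, .refl, ⟨⟨(hv'.equiv ψ).symm, he'.equiv ε, ?_, ?_⟩⟩⟩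
    · rintro ⟨f, hf⟩
      have hm := S.tail_mem _ (he'.mapsTo hf)
      have : (hv'.equiv ψ) ⟨S.tail (ε f), hm⟩ = ⟨H.tail f, H.tail_mem f hf⟩ :=
        Subtype.ext (ht f hf)
      rw [← this, Equiv.symm_apply_apply]
      rfl
    · rintro ⟨f, hf⟩
      have hm := S.head_mem _ (he'.mapsTo hf)
      have : (hv'.equiv ψ) ⟨S.head (ε f), hm⟩ = ⟨H.head f, H.head_mem f hf⟩ :=
        Subtype.ext (hh f hf)
      rw [← this, Equiv.symm_apply_apply]
      rfl
  | insert e T heT ih =>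
    intro S h hT hu hd hψ hv he ht hh
    have heS : e ∈ S.edges := hT (by simp)
    have hne : S.tail e ≠ S.head e := fun hc => by
      have := hd e (by simp)
      rw [hc] at this
      exact lt_irrefl _ this
    have hc : S.ButterflyContractible e := ⟨heS, hne, .inl (hu e (by simp))⟩
    have hmerge : ∀ x, ψ (S.mergeEnds e x) = ψ x := by
      intro x
      unfold mergeEnds
      split_ifs with hx
      · rw [hx]; exact hψ e (by simp)
      · rfl
    have hTne : ∀ f ∈ T, S.tail f ≠ S.tail e := fun f hf hfe => by
      have := hu e (by simp) f (hT (by simp [hf])) hfe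
      exact heT (this ▸ hf)
    have hnt : ∀ f ∈ T, S.mergeEnds e (S.tail f) = S.tail e → S.tail f = S.head e := by
      intro f hf hfe
      unfold mergeEnds at hfe
      split_ifs at hfe with hx
      · exact hx
      · exact absurd hfe (hTne f hf)
    -- The merged vertex bears the name of the tail of `e` but plays the part of its head: its
    -- remaining outgoing `T`-edge, if any, is that of the head. Hence it inherits the head's
    -- potential.
    refine (ih (S.contract e heS hne)
      (fun x => if x = S.tail e then h (S.head e) else h x) ?_ ?_ ?_ ?_ ?_ ?_ ?_ ?_).imp
      fun M hM => ⟨Relation.ReflTransGen.head ⟨e, hc, rfl⟩ hM.1, hM.2⟩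
    · intro f hf
      exact ⟨hT (by simp [Finset.mem_coe.1 hf]), fun hfe => heT (hfe ▸ hf)⟩
    · rintro f hf f' ⟨hf', hne'⟩ heq
      refine hu f (by simp [hf]) f' hf' ?_
      have hf'e : S.tail f' ≠ S.tail e := fun hc => hne' (hu e (by simp) f' hf' hc)
      have hfe := hTne f hf
      change S.mergeEnds e (S.tail f') = S.mergeEnds e (S.tail f) at heq
      unfold mergeEnds at heq
      split_ifs at heq with h1 h2 h2
      · rw [h1, h2]
      · exact absurd heq.symm hfe
      · exact absurd heq hf'e
      · exact heq
    · intro f hf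
      have h1 := hd f (by simp [hf])
      have h2 := hd e (by simp)
      have hfe := hTne f hf
      change (if S.mergeEnds e (S.head f) = S.tail e then h (S.head e)
        else h (S.mergeEnds e (S.head f))) <
        if S.mergeEnds e (S.tail f) = S.tail e then h (S.head e)
        else h (S.mergeEnds e (S.tail f))
      unfold mergeEnds
      generalize S.tail f = a at *
      generalize S.head f = b at *
      generalize S.tail e = p at *
      generalize S.head e = q at *
      clear hu hd hψ hv he ht hh hmerge hnt ih hTne hT hc
      by_cases ha : a = q
      · subst ha
        have hb : b ≠ a := fun hb => by rw [hb] at h1; omega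
        have hb' : b ≠ p := fun hb => by rw [hb] at h1; omega
        simpa only [if_neg hb, if_neg hb', if_true] using h1
      · by_cases hb : b = q
        · subst hb
          simpa only [if_neg ha, if_neg hfe, if_true] using h1
        · by_cases hb' : b = p
          · subst hb'
            simp only [if_neg ha, if_neg hb, if_neg hfe, if_true]
            omega
          · simpa only [if_neg ha, if_neg hb, if_neg hb', if_neg hfe] using h1
    · intro f hf
      change ψ (S.mergeEnds e (S.tail f)) = ψ (S.mergeEnds e (S.head f))
      rw [hmerge, hmerge]
      exact hψ f (by simp [hf])
    · have key : ∀ x, x ∈ (S.contract e heS hne).verts →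
          (∀ f ∈ T, (S.contract e heS hne).tail f ≠ x) →
          ∃ y, y ∈ {x ∈ S.verts | ∀ e' ∈ insert e T, S.tail e' ≠ x} ∧ ψ y = ψ x ∧
            x = S.mergeEnds e y := by
        rintro x ⟨hx, hxe⟩ hxT
        have hxe : x ≠ S.head e := hxe
        by_cases hxt : x = S.tail e
        · refine ⟨S.head e, ⟨S.head_mem e heS, ?_⟩, by rw [hxt, hψ e (by simp)],
            by simp [mergeEnds, hxt]⟩
          intro f hf hfe
          rcases Finset.mem_insert.1 hf with rfl | hf
          · exact hne hfe
          · exact hxT f hf (by change S.mergeEnds e (S.tail f) = x; simp [mergeEnds, hfe, hxt])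
        · refine ⟨x, ⟨hx, ?_⟩, rfl, by simp [mergeEnds, hxe]⟩
          intro f hf hfx
          rcases Finset.mem_insert.1 hf with rfl | hf
          · exact hxt hfx.symm
          · exact hxT f hf (by change S.mergeEnds e (S.tail f) = x; simp [mergeEnds, hfx, hxe])
      refine ⟨?_, ?_, ?_⟩
      · rintro x ⟨hx, hxT⟩
        obtain ⟨y, hy, hyx, -⟩ := key x hx hxT
        rw [← hyx]
        exact hv.mapsTo hy
      · rintro x ⟨hx, hxT⟩ x' ⟨hx', hxT'⟩ hxx
        obtain ⟨y, hy, hyx, h1⟩ := key x hx hxT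
        obtain ⟨y', hy', hyx', h1'⟩ := key x' hx' hxT'
        rw [h1, h1', hv.injOn hy hy' (by rw [hyx, hyx']; exact hxx)]
      · intro w hw
        obtain ⟨y, ⟨hy, hyT⟩, rfl⟩ := hv.surjOn hw
        refine ⟨S.mergeEnds e y, ⟨S.mergeEnds_mem heS hne hy, ?_⟩, hmerge y⟩
        intro f hf hfy
        change S.mergeEnds e (S.tail f) = S.mergeEnds e y at hfy
        have h0 := hyT e (by simp)
        have h1 := hyT f (by simp [hf])
        have h2 := hTne f hf
        unfold mergeEnds at hfy
        split_ifs at hfy with ha hy' hy'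
        · exact h1 (ha.trans hy'.symm)
        · exact h0 hfy
        · exact h2 hfy
        · exact h1 hfy
    · have : (S.contract e heS hne).edges \ (T : Set E) = S.edges \ ↑(insert e T) := by
        ext f
        simp only [contract, Set.mem_sdiff, Set.mem_singleton_iff, Finset.coe_insert,
          Set.mem_insert_iff, not_or, and_assoc]
      rw [this]
      exact he
    · intro f hf
      change ψ (S.mergeEnds e (S.tail (ε f))) = _
      rw [hmerge, ht f hf]
    · intro f hf
      change ψ (S.mergeEnds e (S.head (ε f))) = _
      rw [hmerge, hh f hf]

/-- A butterfly model of a simple digraph `H` in which every branch set is an in-tree: `ψ` tells the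
branch set of a vertex, `ρ` gives the roots, and every vertex of `X` other than a root has an edge
within its branch set that decreases `h`. All edges between branch sets leave from roots. -/
theorem isButterflyMinor_of_inTrees {D : MultiDigraph V E} {H : MultiDigraph W F}
    (hHv : H.verts = Set.univ) (hHe : H.edges = Set.univ)
    (hH : ∀ f g, H.tail f = H.tail g → H.head f = H.head g → f = g)
    {X : Set V} (hX : X.Finite) (hXD : X ⊆ D.verts) (ψ : V → W) (ρ : W → V) (h : V → ℕ)
    (hρ : ∀ w, ρ w ∈ X) (hψ : ∀ w, ψ (ρ w) = w)
    (hn : ∀ x ∈ X, x ≠ ρ (ψ x) → ∃ y ∈ X, D.Adj x y ∧ ψ y = ψ x ∧ h y < h x)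
    (he : ∀ f, ∃ y ∈ X, D.Adj (ρ (H.tail f)) y ∧ ψ y = H.head f) :
    H.IsButterflyMinor D := by
  classical
  have hn' : ∀ x : {x // x ∈ X ∧ x ≠ ρ (ψ x)}, ∃ e ∈ D.edges, D.tail e = x ∧ D.head e ∈ X ∧
      ψ (D.head e) = ψ x ∧ h (D.head e) < h x := by
    rintro ⟨x, hx, hxρ⟩
    obtain ⟨y, hy, ⟨e, he, het, rfl⟩, hyx, hlt⟩ := hn x hx hxρ
    exact ⟨e, he, het, hy, hyx, hlt⟩
  choose p hpD hpt hpX hpψ hph using hn'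
  have he' : ∀ f, ∃ e ∈ D.edges, D.tail e = ρ (H.tail f) ∧ D.head e ∈ X ∧
      ψ (D.head e) = H.head f := by
    intro f
    obtain ⟨y, hy, ⟨e, he, het, rfl⟩, hyx⟩ := he f
    exact ⟨e, he, het, hy, hyx⟩
  choose ε hεD hεt hεX hεψ using he'
  have hρinj : Function.Injective ρ := Function.LeftInverse.injective hψ
  have hεinj : Function.Injective ε := fun f g hfg => by
    refine hH f g (hρinj ?_) ?_
    · rw [← hεt, ← hεt, hfg]
    · rw [← hεψ, ← hεψ, hfg]
  have hεp : ∀ f x, ε f ≠ p x := by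
    rintro f ⟨x, hx, hxρ⟩ hfx
    have : x = ρ (H.tail f) := by rw [← hεt, hfx, hpt]
    apply hxρ
    rw [this, hψ]
  have : Finite {x // x ∈ X ∧ x ≠ ρ (ψ x)} := (hX.subset fun x hx => hx.1).to_subtype
  have hT : (Set.range p).Finite := Set.finite_range p
  -- One edge is kept per non-root and one per edge of `H`. As the latter start at roots, `p x` is
  -- the only edge of `S` leaving `x`.
  let S : MultiDigraph V E :=
    { verts := X
      edges := Set.range p ∪ Set.range ε
      tail := D.tail
      head := D.head
      tail_mem := by
        rintro _ (⟨x, rfl⟩ | ⟨f, rfl⟩)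
        · rw [hpt]; exact x.2.1
        · rw [hεt]; exact hρ _
      head_mem := by
        rintro _ (⟨x, rfl⟩ | ⟨f, rfl⟩)
        · exact hpX x
        · exact hεX f }
  have hTm : ∀ e, e ∈ hT.toFinset ↔ ∃ x, p x = e := by simp
  have hSD : S.IsSubgraph D := by
    refine ⟨hXD, ?_, fun _ _ => rfl, fun _ _ => rfl⟩
    rintro _ (⟨x, rfl⟩ | ⟨f, rfl⟩)
    · exact hpD x
    · exact hεD f
  refine ⟨S, (exists_contraction_iso (H := H) (ψ := ψ) (ε := ε) hT.toFinset S h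
    ?_ ?_ ?_ ?_ ?_ ?_ ?_ ?_).imp fun M hM => ⟨hSD, hM⟩⟩
  · rw [Set.Finite.coe_toFinset]
    exact Set.subset_union_left
  · intro e heT f hf hfe
    obtain ⟨x, rfl⟩ := (hTm e).1 heT
    change D.tail f = D.tail (p x) at hfe
    rcases hf with ⟨y, rfl⟩ | ⟨g, rfl⟩
    · rw [hpt, hpt] at hfe
      rw [Subtype.ext hfe]
    · rw [hpt, hεt] at hfe
      exact absurd (by rw [← hfe, hψ]) x.2.2
  · intro e heT
    obtain ⟨x, rfl⟩ := (hTm e).1 heT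
    change h (D.head (p x)) < h (D.tail (p x))
    rw [hpt]
    exact hph x
  · intro e heT
    obtain ⟨x, rfl⟩ := (hTm e).1 heT
    change ψ (D.tail (p x)) = ψ (D.head (p x))
    rw [hpt, hpψ]
  · have hroot : ∀ x, x ∈ {x ∈ S.verts | ∀ e ∈ hT.toFinset, S.tail e ≠ x} → x = ρ (ψ x) := by
      rintro x ⟨hx, hxT⟩
      by_contra hc
      exact hxT (p ⟨x, hx, hc⟩) ((hTm _).2 ⟨_, rfl⟩) (hpt ⟨x, hx, hc⟩)
    refine ⟨fun x _ => by rw [hHv]; trivial, ?_, ?_⟩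
    · intro x hx y hy hxy
      rw [hroot x hx, hroot y hy, hxy]
    · intro w _
      refine ⟨ρ w, ⟨hρ w, ?_⟩, hψ w⟩
      intro e heT hew
      obtain ⟨x, rfl⟩ := (hTm e).1 heT
      change D.tail (p x) = ρ w at hew
      rw [hpt] at hew
      exact x.2.2 (by rw [hew, hψ])
  · refine ⟨?_, hεinj.injOn, ?_⟩
    · intro f _
      refine ⟨.inr ⟨f, rfl⟩, ?_⟩
      rw [Set.Finite.coe_toFinset]
      rintro ⟨x, hx⟩
      exact hεp f x hx.symm
    · rintro e ⟨⟨x, rfl⟩ | ⟨f, rfl⟩, h2⟩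
      · exact absurd ((hTm _).2 ⟨x, rfl⟩) h2
      · exact ⟨f, by rw [hHe]; trivial, rfl⟩
  · intro f _
    change ψ (D.tail (ε f)) = _
    rw [hεt, hψ]
  · intro f _
    exact hεψ f

/-! ### Reversed reachability and long directed cycles -/

theorem StronglyConnected.flip_reach {D : MultiDigraph V E} (hD : D.StronglyConnected) :
    ∀ u ∈ D.verts, ∀ v ∈ D.verts, Relation.ReflTransGen (flip D.Adj) u v := by
  intro u hu v hv
  rw [Relation.reflTransGen_swap]
  exact hD v hv u hu

/-- A directed cycle of length at least `n` contracts to the directed cycle of length `n`. -/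
theorem directedCycle_isButterflyMinor {D : MultiDigraph V E} {n m : ℕ} (hn : 1 ≤ n) (hm : n ≤ m)
    (c : ℕ → V) (hc : Set.InjOn c (Set.Iio m)) (hadj : ∀ k, k + 1 < m → D.Adj (c k) (c (k + 1)))
    (hlast : D.Adj (c (m - 1)) (c 0)) : (directedCycle n).IsButterflyMinor D := by
  have hverts : ∀ k < m, c k ∈ D.verts := by
    intro k hk
    by_cases hk' : k + 1 < m
    · obtain ⟨e, he, ht, -⟩ := hadj k hk'
      exact ht ▸ D.tail_mem e he
    · obtain ⟨e, he, ht, -⟩ := hlast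
      have : k = m - 1 := by omega
      rw [this]
      exact ht ▸ D.tail_mem e he
  obtain ⟨N, rfl⟩ : ∃ N, n = N + 1 := ⟨n - 1, by omega⟩
  let idx : V → ℕ := Function.invFunOn c (Set.Iio m)
  have hidx : ∀ k < m, idx (c k) = k := fun k hk => hc.leftInvOn_invFunOn hk
  -- The last branch set absorbs all surplus vertices of the cycle; its root is the final vertex `c
  -- (m - 1)`, from which the closing edge leaves.
  let ψ : V → Fin (N + 1) := fun x => ⟨min (idx x) N, by omega⟩
  let r : Fin (N + 1) → ℕ := fun w => if (w : ℕ) = N then m - 1 else w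
  have hr : ∀ w, r w < m := by
    intro w
    have := w.2
    simp only [r]
    split_ifs <;> omega
  refine isButterflyMinor_of_inTrees rfl rfl (fun f g h _ => h) (X := c '' Set.Iio m)
    ((Set.finite_Iio m).image c) ?_ ψ (fun w => c (r w)) (fun x => m - idx x)
    (fun w => ⟨r w, hr w, rfl⟩) ?_ ?_ ?_
  · rintro _ ⟨k, hk, rfl⟩
    exact hverts k hk
  · intro w
    apply Fin.ext
    have := w.2
    simp only [ψ, hidx _ (hr w), r]
    split_ifs <;> omega
  · rintro _ ⟨k, hk, rfl⟩ hne
    have hk : k < m := hk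
    have hk' : k ≠ r (ψ (c k)) := fun h => hne (congrArg c h)
    have hkN : N ≤ k ∧ k + 1 < m := by
      simp only [ψ, hidx _ hk, r] at hk'
      split_ifs at hk' <;> omega
    refine ⟨c (k + 1), ⟨k + 1, hkN.2, rfl⟩, hadj k hkN.2, ?_, ?_⟩
    · apply Fin.ext
      simp only [ψ, hidx _ hk, hidx _ hkN.2]
      omega
    · rw [hidx _ hk, hidx _ hkN.2]
      omega
  · intro f
    change Fin (N + 1) at f
    change ∃ y ∈ c '' Set.Iio m, D.Adj (c (r f)) y ∧ ψ y = finRotate (N + 1) f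
    have hf := f.2
    by_cases hfN : (f : ℕ) = N
    · refine ⟨c 0, ⟨0, by simp; omega, rfl⟩, ?_, ?_⟩
      · simpa only [r, hfN, if_true] using hlast
      · apply Fin.ext
        have : f = Fin.last N := Fin.ext hfN
        simp [ψ, hidx 0 (by omega), this]
    · have h1 : r f = f := by simp [r, hfN]
      refine ⟨c (f + 1), ⟨f + 1, by simp; omega, rfl⟩, ?_, ?_⟩
      · rw [h1]; exact hadj _ (by omega)
      · apply Fin.ext
        rw [coe_finRotate_of_ne_last (fun h => hfN (by simp [h]))]
        simp only [ψ, hidx (f + 1) (by omega)]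
        omega

/-! ### Cheapest walks, pigeonhole and breadth-first trees -/

/-- `WalkCost R cost u k x`: there is an `R`-walk of cost `k` from `x` to `u`. -/
inductive WalkCost (R : V → V → Prop) (cost : V → V → ℕ) (u : V) : ℕ → V → Prop
  | base : WalkCost R cost u 0 u
  | step {x y : V} {k : ℕ} : R x y → WalkCost R cost u k y →
      WalkCost R cost u (cost x y + k) x

/-- Weighted distances to `u`, together with a choice of the next vertex on a cheapest walk. -/
theorem exists_distance (R : V → V → Prop) (cost : V → V → ℕ)
    (U : Set V) (u : V) (hreach : ∀ x ∈ U, Relation.ReflTransGen R x u) :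
    ∃ (d : V → ℕ) (nxt : V → V), d u = 0 ∧ nxt u = u ∧
      (∀ x ∈ U, x ≠ u → R x (nxt x) ∧ d x = cost x (nxt x) + d (nxt x)) ∧
      (∀ x ∈ U, ∀ y ∈ U, R x y → d x ≤ cost x y + d y) := by
  classical
  have hex : ∀ x ∈ U, ∃ k, WalkCost R cost u k x := by
    intro x hx
    have := hreach x hx
    clear hx
    induction this using Relation.ReflTransGen.head_induction_on with
    | refl => exact ⟨0, .base⟩
    | head h _ ih =>
      obtain ⟨k, hk⟩ := ih
      exact ⟨_, .step h hk⟩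
  let d : V → ℕ := fun x => sInf {k | WalkCost R cost u k x}
  have hd : ∀ x k, WalkCost R cost u k x → WalkCost R cost u (d x) x := fun x k hk =>
    Nat.sInf_mem (s := {k | WalkCost R cost u k x}) ⟨k, hk⟩
  have hle : ∀ x k, WalkCost R cost u k x → d x ≤ k := fun x k hk => Nat.sInf_le hk
  have hstep : ∀ x ∈ U, x ≠ u → ∃ y, R x y ∧ d x = cost x y + d y := by
    intro x hx hxu
    obtain ⟨k, hk⟩ := hex x hx
    have h1 := hd x k hk
    generalize hdx : d x = a at h1
    cases h1 with
    | base => exact absurd rfl hxu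
    | @step _ y k hR hW =>
      refine ⟨y, hR, le_antisymm ?_ ?_⟩
      · rw [← hdx]; exact hle _ _ (.step hR (hd y _ hW))
      · exact Nat.add_le_add_left (hle y _ hW) _
  choose! nxt hnxt using hstep
  have hdu : d u = 0 := Nat.le_zero.1 (hle u 0 .base)
  refine ⟨d, fun x => if x = u then u else nxt x, hdu, by simp, ?_, ?_⟩
  · intro x hx hxu
    simpa only [if_neg hxu] using hnxt x hx hxu
  · intro x hx y hy hR
    obtain ⟨k, hk⟩ := hex y hy
    exact hle _ _ (.step hR (hd y k hk))

/-- If `f` sends a large finite set to a point within `L` steps, then at some step many points of its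
image are sent to the same point. -/
theorem exists_large_fiber [DecidableEq V] (f : V → V) (r : V) (m : ℕ) :
    ∀ (L : ℕ) (A : Finset V), (∀ a ∈ A, f^[L] a = r) → m ^ L < A.card →
      ∃ (k : ℕ) (w : V) (B : Finset V), k < L ∧ B ⊆ A.image f^[k] ∧ m < B.card ∧
        ∀ b ∈ B, f b = w := by
  intro L
  induction L with
  | zero =>
    intro A hA hcard
    have : A ⊆ {r} := fun a ha => by simpa using hA a ha
    have := Finset.card_le_card this
    simp at this hcard
    omega
  | succ L ih =>
    intro A hA hcard
    by_cases hbig : m ^ L < (A.image f).card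
    · obtain ⟨k, w, B, hk, hB, hm, hw⟩ := ih (A.image f) (by
        intro a ha
        obtain ⟨b, hb, rfl⟩ := Finset.mem_image.1 ha
        exact hA b hb) hbig
      refine ⟨k + 1, w, B, by omega, ?_, hm, hw⟩
      rwa [Finset.image_image, ← Function.iterate_succ] at hB
    · obtain ⟨w, -, hw⟩ := Finset.exists_lt_card_fiber_of_mul_lt_card_of_maps_to
        (s := A) (t := A.image f) (f := f) (n := m) (fun a ha => Finset.mem_image_of_mem f ha)
        (lt_of_le_of_lt (by rw [pow_succ]; exact Nat.mul_le_mul_right _ (not_lt.1 hbig)) hcard)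
      refine ⟨0, w, A.filter (fun a => f a = w), by omega, ?_, hw, ?_⟩
      · intro a ha
        simpa using (Finset.mem_filter.1 ha).1
      · intro b hb
        exact (Finset.mem_filter.1 hb).2

/-- A breadth-first tree towards `u`, given by the depth `d` and the parent function `f`. -/
theorem exists_bfsTree (R : V → V → Prop) (U : Set V) {u : V} (hu : u ∈ U)
    (hU : ∀ x y, R x y → y ∈ U) (hreach : ∀ x ∈ U, Relation.ReflTransGen R x u) :
    ∃ (d : V → ℕ) (f : V → V), d u = 0 ∧ f u = u ∧ (∀ x ∈ U, d x = 0 → x = u) ∧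
      (∀ x ∈ U, x ≠ u → R x (f x)) ∧ ∀ i, ∀ x ∈ U, f^[i] x ∈ U ∧ d (f^[i] x) = d x - i := by
  obtain ⟨d, f, hdu, hfu, hf, -⟩ := exists_distance R (fun _ _ => 1) U u hreach
  refine ⟨d, f, hdu, hfu, ?_, fun x hx hxu => (hf x hx hxu).1, ?_⟩
  · intro x hx hdx
    by_contra hxu
    have := (hf x hx hxu).2
    omega
  · intro i
    induction i with
    | zero => exact fun x hx => ⟨hx, rfl⟩
    | succ i ih =>
      intro x hx
      rw [Function.iterate_succ_apply]
      by_cases hxu : x = u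
      · rw [hxu, hfu]
        obtain ⟨h1, h2⟩ := ih u hu
        exact ⟨h1, by rw [h2, hdu]; omega⟩
      · obtain ⟨hR, hd⟩ := hf x hx hxu
        obtain ⟨h1, h2⟩ := ih _ (hU _ _ hR)
        exact ⟨h1, by rw [h2]; omega⟩

theorem iterate_eq_root {d : V → ℕ} {f : V → V} {U : Set V} {u x : V} {L : ℕ}
    (hd0 : ∀ x ∈ U, d x = 0 → x = u)
    (hit : ∀ i, ∀ x ∈ U, f^[i] x ∈ U ∧ d (f^[i] x) = d x - i) (hx : x ∈ U) (hL : d x ≤ L) :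
    f^[L] x = u := by
  obtain ⟨h1, h2⟩ := hit L x hx
  exact hd0 _ h1 (by omega)

theorem iterate_injOn {d : V → ℕ} {f : V → V} {U : Set V} {x : V} {L : ℕ}
    (hit : ∀ i, ∀ x ∈ U, f^[i] x ∈ U ∧ d (f^[i] x) = d x - i) (hx : x ∈ U) (hL : L ≤ d x) :
    Set.InjOn (fun i => f^[i] x) (Set.Iic L) := by
  intro i hi j hj hij
  have hi : i ≤ L := hi
  have hj : j ≤ L := hj
  have h1 := (hit i x hx).2
  have h2 := (hit j x hx).2
  have hij : f^[i] x = f^[j] x := hij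
  rw [hij] at h1
  omega

/-! ### No long path: the star -/

theorem Adj.tail_mem {D : MultiDigraph V E} {x y : V} (h : D.Adj x y) : x ∈ D.verts := by
  obtain ⟨e, he, rfl, -⟩ := h
  exact D.tail_mem e he

theorem Adj.head_mem {D : MultiDigraph V E} {x y : V} (h : D.Adj x y) : y ∈ D.verts := by
  obtain ⟨e, he, -, rfl⟩ := h
  exact D.head_mem e he

theorem ofSimpleGraph_ext {W : Type*} (G : SimpleGraph W) (f g : G.Dart)
    (ht : (ofSimpleGraph G).tail f = (ofSimpleGraph G).tail g)
    (hh : (ofSimpleGraph G).head f = (ofSimpleGraph G).head g) : f = g :=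
  SimpleGraph.Dart.ext _ _ (Prod.ext ht hh)

theorem ofSimpleGraph_isButterflyMinor_of_subsingleton {W : Type*} [Unique W] (G : SimpleGraph W)
    {D : MultiDigraph V E} (hne : D.verts.Nonempty) :
    (ofSimpleGraph G).IsButterflyMinor D := by
  obtain ⟨v, hv⟩ := hne
  refine isButterflyMinor_of_inTrees rfl rfl (ofSimpleGraph_ext G) (X := {v})
    (Set.finite_singleton v) (by simpa using hv) (fun _ => default) (fun _ => v) (fun _ => 0)
    (by simp) (fun w => Subsingleton.elim _ _) ?_ ?_
  · rintro x hx hne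
    exact absurd hx hne
  · intro f
    exact absurd (Subsingleton.elim _ _) f.adj.ne

/-- A vertex `r` with many out-neighbours, `n` of which reach a vertex `w` through distinct children
of `w` in a tree towards `r`, gives a star. -/
theorem star_isButterflyMinor_of_tree {D : MultiDigraph V E} {n : ℕ} {r : V} (hr : r ∈ D.verts)
    {d : V → ℕ} {f : V → V} (hdr : d r = 0) (hfr : f r = r)
    (hd0 : ∀ x ∈ D.verts, d x = 0 → x = r) (hf : ∀ x ∈ D.verts, x ≠ r → D.Adj x (f x))
    (hit : ∀ i, ∀ x ∈ D.verts, f^[i] x ∈ D.verts ∧ d (f^[i] x) = d x - i)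
    {k : ℕ} {w : V} {a : Fin n → V} (ha : ∀ i, D.Adj r (a i))
    (hinj : Function.Injective fun i => f^[k] (a i))
    (hw : ∀ i, f (f^[k] (a i)) = w) (hne : ∀ i, f^[k] (a i) ≠ w) :
    (ofSimpleGraph (completeBipartiteGraph (Fin 1) (Fin n))).IsButterflyMinor D := by
  classical
  set c : Fin n → V := fun i => f^[k] (a i) with hc
  have haD : ∀ i, a i ∈ D.verts := fun i => (ha i).head_mem
  have hcD : ∀ i, c i ∈ D.verts := fun i => (hit k _ (haD i)).1
  have hcr : ∀ i, c i ≠ r := by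
    intro i h
    have h1 := hw i
    rw [show f^[k] (a i) = r from h, hfr] at h1
    exact hne i (h.trans h1)
  have hcd : ∀ i, d (c i) = d w + 1 := by
    intro i
    have h1 := (hit 1 _ (hcD i)).2
    have h2 : d (c i) ≠ 0 := fun h => hcr i (hd0 _ (hcD i) h)
    rw [Function.iterate_one, show f (c i) = w from hw i] at h1
    omega
  have hwD : ∀ i : Fin n, w ∈ D.verts := fun i => hw i ▸ (hit 1 _ (hcD i)).1
  -- All `c i` have the same depth, and depth drops at every step before the root, so a tree walk
  -- meets at most one of them.
  have huniq : ∀ x ∈ D.verts, ∀ i j s t, f^[s] x = c i → f^[t] x = c j → i = j := by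
    intro x hx i j s t hs ht
    have h1 := (hit s x hx).2
    have h2 := (hit t x hx).2
    rw [hs, hcd] at h1
    rw [ht, hcd] at h2
    apply hinj
    rw [← hs, ← ht, show s = t by omega]
  let ψ : V → Fin 1 ⊕ Fin n := fun x =>
    if h : ∃ i t, f^[t] x = c i then .inr h.choose else .inl 0
  have hψr : ∀ x ∈ D.verts, ∀ i t, f^[t] x = c i → ψ x = .inr i := by
    intro x hx i t h
    have hex : ∃ i t, f^[t] x = c i := ⟨i, t, h⟩
    simp only [ψ, dif_pos hex]
    obtain ⟨s, hs⟩ := hex.choose_spec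
    rw [huniq x hx _ _ _ _ hs h]
  have hψl : ∀ x, (¬ ∃ i t, f^[t] x = c i) → ψ x = .inl 0 := fun x h => dif_neg h
  have hlow : ∀ x ∈ D.verts, d x ≤ d w → ψ x = .inl 0 := by
    intro x hx hxw
    apply hψl
    rintro ⟨i, t, h⟩
    have h1 := (hit t x hx).2
    rw [h, hcd] at h1
    omega
  let X : Set V := {x | x = r ∨ ∃ i t, f^[t] (a i) = x}
  have hXD : X ⊆ D.verts := by
    rintro x (rfl | ⟨i, t, rfl⟩)
    · exact hr
    · exact (hit t _ (haD i)).1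
  have hXf : X.Finite := by
    have : X ⊆ {r} ∪ ⋃ i, (fun t => f^[t] (a i)) '' Set.Iic (d (a i)) := by
      rintro x (rfl | ⟨i, t, rfl⟩)
      · simp
      · by_cases ht : t ≤ d (a i)
        · right
          exact Set.mem_iUnion.2 ⟨i, t, ht, rfl⟩
        · left
          obtain ⟨h1, h2⟩ := hit t _ (haD i)
          exact hd0 _ h1 (by omega)
    exact ((Set.finite_singleton r).union
      (Set.finite_iUnion fun i => (Set.finite_Iic _).image _)).subset this
  refine isButterflyMinor_of_inTrees rfl rfl (ofSimpleGraph_ext _) hXf hXD ψ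
    (Sum.elim (fun _ => r) c) d ?_ ?_ ?_ ?_
  · rintro (z | i)
    · exact .inl rfl
    · exact .inr ⟨i, k, rfl⟩
  · rintro (z | i)
    · rw [Subsingleton.elim z 0]
      exact hlow r hr (by omega)
    · exact hψr _ (hcD i) i 0 rfl
  · intro x hx hxρ
    have hxD := hXD hx
    have hxr : x ≠ r := by
      rintro rfl
      rw [hlow x hr (by omega)] at hxρ
      exact hxρ rfl
    have hd1 := (hit 1 x hxD).2
    have hd2 : d x ≠ 0 := fun h => hxr (hd0 x hxD h)
    refine ⟨f x, ?_, hf x hxD hxr, ?_, ?_⟩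
    · rcases hx with rfl | ⟨i, t, rfl⟩
      · exact absurd rfl hxr
      · exact .inr ⟨i, t + 1, Function.iterate_succ_apply' f t _⟩
    · by_cases hex : ∃ i t, f^[t] x = c i
      · obtain ⟨i, t, ht⟩ := hex
        have hψx := hψr x hxD i t ht
        rw [hψx] at hxρ ⊢
        cases t with
        | zero => exact absurd ht hxρ
        | succ t =>
          rw [Function.iterate_succ_apply] at ht
          exact hψr _ (hit 1 x hxD).1 i t ht
      · rw [hψl x hex]
        apply hψl
        rintro ⟨i, t, ht⟩
        exact hex ⟨i, t + 1, ht⟩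
    · rw [Function.iterate_one] at hd1
      omega
  · intro e
    have hadj := e.adj
    change ∃ y ∈ X, D.Adj (Sum.elim (fun _ => r) c e.fst) y ∧ ψ y = e.snd
    generalize e.fst = p at *
    generalize e.snd = q at *
    rcases p with p | i <;> rcases q with q | j
    · simp at hadj
    · exact ⟨a j, .inr ⟨j, 0, rfl⟩, ha j, hψr _ (haD j) j k rfl⟩
    · refine ⟨w, .inr ⟨i, k + 1, ?_⟩, ?_, ?_⟩
      · rw [Function.iterate_succ_apply']
        exact hw i
      · have := hf (c i) (hcD i) (hcr i)
        rwa [show f (c i) = w from hw i] at this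
      · rw [Subsingleton.elim q 0]
        exact hlow w (hwD i) le_rfl
    · simp at hadj

/-- Pigeonhole is used twice: in an out-tree to find a vertex `r` of large out-degree, then in an
in-tree towards `r` to find the place where many walks from its out-neighbours merge. The absence of
a path with `L` edges bounds both depths. -/
theorem star_isButterflyMinor {D : MultiDigraph V E} (hD : D.StronglyConnected) {n L : ℕ}
    (hpath : ¬ ∃ x : ℕ → V, Set.InjOn x (Set.Iic L) ∧ ∀ i < L, D.Adj (x i) (x (i + 1)))
    (hcard : (((n ^ L + 1) ^ L + 1 : ℕ) : ℕ∞) ≤ D.verts.encard) :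
    (ofSimpleGraph (completeBipartiteGraph (Fin 1) (Fin n))).IsButterflyMinor D := by
  classical
  obtain ⟨A', hA', hAcard⟩ := Set.exists_subset_encard_eq hcard
  have hAfin : A'.Finite := Set.finite_of_encard_eq_coe hAcard
  obtain ⟨A, rfl⟩ := hAfin.exists_finset_coe
  rw [Set.encard_coe_eq_coe_finsetCard, Nat.cast_inj] at hAcard
  have hAne : A.Nonempty := by
    rw [← Finset.card_pos]
    omega
  obtain ⟨u, huA⟩ := hAne
  have hu := hA' huA
  obtain ⟨d, f, hdu, hfu, hd0, hf, hit⟩ := exists_bfsTree (flip D.Adj) D.verts hu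
    (fun x y h => Adj.tail_mem h) fun x hx => hD.flip_reach x hx u hu
  have hnL : ∀ x ∈ D.verts, d x ≤ L := by
    intro x hx
    by_contra! hc
    have hc := hc.le
    -- Parents in the tree are in-neighbours, so the iterates of `f` have to be read backwards to
    -- give a directed path.
    refine hpath ⟨fun i => f^[L - i] x, ?_, ?_⟩
    · intro i hi j hj hij
      have hi : i ≤ L := hi
      have hj : j ≤ L := hj
      have := iterate_injOn hit hx hc (Nat.sub_le L i) (Nat.sub_le L j) hij
      omega
    · intro i hi
      have h1 := hit (L - (i + 1)) x hx
      have h2 := hf _ h1.1 (fun h => by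
        rw [h, hdu] at h1
        omega)
      rw [← Function.iterate_succ_apply' f, show (L - (i + 1)).succ = L - i by omega] at h2
      exact h2
  obtain ⟨k, r, B, hk, hB, hBcard, hBr⟩ := exists_large_fiber f u (n ^ L + 1) L A
    (fun a ha => iterate_eq_root hd0 hit (hA' ha) (hnL a (hA' ha))) (by omega)
  have hBD : ∀ b ∈ B, b ∈ D.verts := by
    intro b hb
    obtain ⟨a, ha, rfl⟩ := Finset.mem_image.1 (hB hb)
    exact (hit k a (hA' ha)).1
  have hBadj : ∀ b ∈ B.erase r, D.Adj r b := by
    intro b hb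
    obtain ⟨hbr, hb⟩ := Finset.mem_erase.1 hb
    have hbu : b ≠ u := by
      rintro rfl
      exact hbr (hfu ▸ hBr b hb)
    have := hf b (hBD b hb) hbu
    rwa [hBr b hb] at this
  -- The summand 1 in `n ^ L + 1` pays for removing `r`, which lies in its own fibre if it is the
  -- root `u`.
  have hBcard' : n ^ L < (B.erase r).card := by
    have := Finset.pred_card_le_card_erase (a := r) (s := B)
    omega
  have hr : r ∈ D.verts := by
    obtain ⟨b, hb⟩ := Finset.card_pos.1 (by omega : 0 < B.card)
    rw [← hBr b hb]
    exact (hit 1 b (hBD b hb)).1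
  -- The out-tree is no longer needed; an in-tree towards `r` replaces it.
  clear! d f
  obtain ⟨d, f, hdr, hfr, hd0, hf, hit⟩ := exists_bfsTree D.Adj D.verts hr
    (fun x y h => Adj.head_mem h) fun x hx => hD x hx r hr
  have hnL : ∀ x ∈ D.verts, d x ≤ L := by
    intro x hx
    by_contra! hc
    have hc := hc.le
    refine hpath ⟨fun i => f^[i] x, iterate_injOn hit hx hc, ?_⟩
    intro i hi
    have h1 := hit i x hx
    have h2 := hf _ h1.1 (fun h => by
      rw [h, hdr] at h1
      omega)
    rw [← Function.iterate_succ_apply' f] at h2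
    exact h2
  obtain ⟨k, w, C, hk, hC, hCcard, hCw⟩ := exists_large_fiber f r n L (B.erase r)
    (fun a ha => iterate_eq_root hd0 hit (hBadj a ha).head_mem (hnL a (hBadj a ha).head_mem))
    hBcard'
  have hCcard' : Fintype.card (Fin n) ≤ Fintype.card ↥(C.erase w) := by
    have := Finset.pred_card_le_card_erase (a := w) (s := C)
    rw [Fintype.card_fin, Fintype.card_coe]
    omega
  obtain ⟨φ⟩ := Function.Embedding.nonempty_of_card_le hCcard'
  have hφ : ∀ i, ∃ a ∈ B.erase r, f^[k] a = φ i := fun i =>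
    Finset.mem_image.1 (hC (Finset.mem_of_mem_erase (φ i).2))
  choose a ha hak using hφ
  refine star_isButterflyMinor_of_tree (k := k) (w := w) (a := a) hr hdr hfr hd0 hf hit
    (fun i => hBadj _ (ha i)) ?_ ?_ ?_
  · intro i j hij
    simp only [hak] at hij
    exact φ.injective (Subtype.ext hij)
  · intro i
    rw [hak]
    exact hCw _ (Finset.mem_of_mem_erase (φ i).2)
  · intro i
    rw [hak]
    exact Finset.ne_of_mem_erase (φ i).2

/-! ### A long path: cheapest walks back along it -/

theorem iterate_mem_and_le {U : Set V} {u : V} {d : V → ℕ} {f : V → V} (hu : f u = u)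
    (hf : ∀ y ∈ U, y ≠ u → f y ∈ U ∧ d (f y) < d y) (t : ℕ) :
    ∀ y ∈ U, f^[t] y ∈ U ∧ d (f^[t] y) ≤ d y := by
  induction t with
  | zero => exact fun y hy => ⟨hy, le_rfl⟩
  | succ t ih =>
    intro y hy
    rw [Function.iterate_succ_apply]
    by_cases hyu : y = u
    · rw [hyu, hu]
      exact ih u (hyu ▸ hy)
    · obtain ⟨h1, h2⟩ := hf y hy hyu
      obtain ⟨h3, h4⟩ := ih _ h1
      exact ⟨h3, h4.trans h2.le⟩

theorem iterate_lt {U : Set V} {u : V} {d : V → ℕ} {f : V → V} (hu : f u = u)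
    (hf : ∀ y ∈ U, y ≠ u → f y ∈ U ∧ d (f y) < d y) {t : ℕ} (ht : 0 < t) {y : V} (hy : y ∈ U)
    (hyu : y ≠ u) : d (f^[t] y) < d y := by
  obtain ⟨t, rfl⟩ : ∃ s, t = s + 1 := ⟨t - 1, by omega⟩
  rw [Function.iterate_succ_apply]
  obtain ⟨h1, h2⟩ := hf y hy hyu
  exact (iterate_mem_and_le hu hf t _ h1).2.trans_lt h2

theorem iterate_eventually {U : Set V} {u : V} {d : V → ℕ} {f : V → V} (hu : f u = u)
    (hf : ∀ y ∈ U, y ≠ u → f y ∈ U ∧ d (f y) < d y) (k : ℕ) :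
    ∀ y ∈ U, d y ≤ k → f^[k] y = u := by
  induction k with
  | zero =>
    intro y hy hd
    by_contra hyu
    have := (hf y hy hyu).2
    omega
  | succ k ih =>
    intro y hy hd
    rw [Function.iterate_succ_apply]
    by_cases hyu : y = u
    · rw [hyu, hu]
      exact Function.iterate_fixed hu k
    · obtain ⟨h1, h2⟩ := hf y hy hyu
      exact ih _ h1 (by omega)

/-- For a directed path `x 0, …, x L` there are walks towards `x 0` which run along the path whenever
they return to the path no earlier than where they left. -/
theorem exists_backward_walks {D : MultiDigraph V E} (hD : D.StronglyConnected) {L : ℕ}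
    {x : ℕ → V} (hx : Set.InjOn x (Set.Iic L)) (hadj : ∀ i < L, D.Adj (x i) (x (i + 1)))
    (hmem : ∀ i ≤ L, x i ∈ D.verts) :
    ∃ (d : V → ℕ) (f : V → V), f (x 0) = x 0 ∧
      (∀ y ∈ D.verts, y ≠ x 0 → D.Adj y (f y) ∧ d (f y) < d y) ∧
      ∀ i j t, i ≤ j → j ≤ L → 0 < j → 0 < t → f^[t] (x i) = x j → i < L ∧ f (x i) = x (i + 1) := by
  classical
  -- A single edge off the path costs more than running along the whole path. A cheapest walk from
  -- `x i` to a later `x j` therefore cannot start with such an edge.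
  let cost : V → V → ℕ := fun y z => if ∃ i < L, y = x i ∧ z = x (i + 1) then 1 else L + 1
  have hcost : ∀ y z, 0 < cost y z := by
    intro y z
    simp only [cost]
    split_ifs <;> omega
  obtain ⟨d, f, hd0, hf0, hf, hd⟩ := exists_distance D.Adj cost D.verts (x 0)
    fun y hy => hD y hy (x 0) (hmem 0 (Nat.zero_le _))
  have hlt : ∀ y ∈ D.verts, y ≠ x 0 → D.Adj y (f y) ∧ d (f y) < d y := by
    intro y hy hy0
    obtain ⟨h1, h2⟩ := hf y hy hy0
    have := hcost y (f y)
    exact ⟨h1, by omega⟩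
  have hlt' : ∀ y ∈ D.verts, y ≠ x 0 → f y ∈ D.verts ∧ d (f y) < d y := fun y hy hy0 =>
    ⟨(hlt y hy hy0).1.head_mem, (hlt y hy hy0).2⟩
  refine ⟨d, f, hf0, hlt, ?_⟩
  intro i j t hij hjL hj ht hit
  have hdij : ∀ s, i + s ≤ L → d (x i) ≤ s + d (x (i + s)) := by
    intro s
    induction s with
    | zero => intro _; simp
    | succ s ih =>
      intro hs
      have h1 := ih (by omega)
      have h2 := hd (x (i + s)) (hmem _ (by omega)) (x (i + s + 1)) (hmem _ (by omega))
        (hadj _ (by omega))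
      have h3 : cost (x (i + s)) (x (i + s + 1)) = 1 := if_pos ⟨i + s, by omega, rfl, rfl⟩
      rw [h3] at h2
      rw [← Nat.add_assoc i s 1]
      omega
  have h1 := hdij (j - i) (by omega)
  rw [show i + (j - i) = j by omega] at h1
  have hi0 : x i ≠ x 0 := by
    intro h
    rw [h, Function.iterate_fixed hf0] at hit
    have := hx (Set.mem_Iic.2 (Nat.zero_le L)) (Set.mem_Iic.2 hjL) hit
    omega
  have hiD := hmem i (by omega)
  obtain ⟨h2, h3⟩ := hf (x i) hiD hi0
  obtain ⟨t, rfl⟩ : ∃ s, t = s + 1 := ⟨t - 1, by omega⟩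
  rw [Function.iterate_succ_apply] at hit
  have h4 := (iterate_mem_and_le hf0 hlt' t _ h2.head_mem).2
  rw [hit] at h4
  by_cases hc : ∃ a < L, x i = x a ∧ f (x i) = x (a + 1)
  · obtain ⟨a, ha, h5, h6⟩ := hc
    have : i = a := hx (Set.mem_Iic.2 (by omega)) (Set.mem_Iic.2 ha.le) h5
    subst this
    exact ⟨ha, h6⟩
  · have : cost (x i) (f (x i)) = L + 1 := if_neg hc
    omega

/-! ### Leaving points and returns -/

theorem count_eq_of_forall_not (p : ℕ → Prop) [DecidablePred p] {a b : ℕ} (hab : a ≤ b)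
    (h : ∀ k, a ≤ k → k < b → ¬ p k) : Nat.count p b = Nat.count p a := by
  induction b, hab using Nat.le_induction with
  | base => rfl
  | succ b hb ih =>
    rw [Nat.count_succ, if_neg (h b hb (by omega)), ih fun k h1 h2 => h k h1 (by omega)]
    rfl

theorem exists_count_eq (p : ℕ → Prop) [DecidablePred p] (N : ℕ) :
    ∀ w < Nat.count p N, ∃ i < N, p i ∧ Nat.count p i = w := by
  induction N with
  | zero => intro w hw; simp at hw
  | succ N ih =>
    intro w hw
    by_cases h : w < Nat.count p N
    · obtain ⟨i, hi, h1⟩ := ih w h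
      exact ⟨i, by omega, h1⟩
    · rw [Nat.count_succ] at hw
      split_ifs at hw with hp
      · exact ⟨N, by omega, hp, by omega⟩
      · omega

/-- The walk that starts in `x L` and follows `f` visits `x i` and does not continue along the
path. -/
def LeavesAt (f : V → V) (x : ℕ → V) (L i : ℕ) : Prop :=
  i ≤ L ∧ (∃ t, f^[t] (x L) = x i) ∧ ¬ (i < L ∧ f (x i) = x (i + 1))

open Classical in
/-- When the walk leaves the path at `x r`, it returns at some `x i` with `i < r` in such a way that
there is exactly one leaving point `x j` with `i ≤ j < r`. -/
theorem LeavesAt.exists_return {U : Set V} {L : ℕ} {x : ℕ → V} {d : V → ℕ} {f : V → V}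
    (hx : Set.InjOn x (Set.Iic L)) (hmem : ∀ i ≤ L, x i ∈ U) (hf0 : f (x 0) = x 0)
    (hf : ∀ y ∈ U, y ≠ x 0 → f y ∈ U ∧ d (f y) < d y)
    (halong : ∀ i j t, i ≤ j → j ≤ L → 0 < j → 0 < t → f^[t] (x i) = x j →
      i < L ∧ f (x i) = x (i + 1))
    {r : ℕ} (hr : LeavesAt f x L r) (hr0 : 0 < r) :
    ∃ i j t, i ≤ j ∧ j < r ∧ LeavesAt f x L j ∧ f^[t] (f (x r)) = x i ∧
      (∀ s < t, ∀ k ≤ L, f^[s] (f (x r)) ≠ x k) ∧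
      Nat.count (LeavesAt f x L) j = Nat.count (LeavesAt f x L) i ∧
      Nat.count (LeavesAt f x L) r = Nat.count (LeavesAt f x L) i + 1 := by
  have hinj : ∀ i j, i ≤ L → j ≤ L → x i = x j → i = j := fun i j hi hj h => hx hi hj h
  have hrL := hr.1
  have hrU := hmem r hrL
  have hrx0 : x r ≠ x 0 := fun h => by
    have := hinj r 0 hrL (by omega) h
    omega
  have hex : ∃ t, ∃ i ≤ L, f^[t] (f (x r)) = x i :=
    ⟨_, 0, by omega, iterate_eventually hf0 hf _ _ (hf _ hrU hrx0).1 le_rfl⟩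
  obtain ⟨i, hiL, hit⟩ := Nat.find_spec hex
  have hmin : ∀ s < Nat.find hex, ∀ k ≤ L, f^[s] (f (x r)) ≠ x k := fun s hs k hk h =>
    Nat.find_min hex hs ⟨k, hk, h⟩
  generalize Nat.find hex = t at hit hmin
  have hir : i < r := by
    by_contra! hc
    exact hr.2.2 (halong r i (t + 1) hc hiL (by omega) (by omega) hit)
  obtain ⟨tr, htr⟩ := hr.2.1
  have hexj : ∃ j, i ≤ j ∧ LeavesAt f x L j := ⟨r, hir.le, hr⟩
  obtain ⟨hij, hj⟩ := Nat.find_spec hexj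
  have hjr : Nat.find hexj ≤ r := Nat.find_min' hexj ⟨hir.le, hr⟩
  have hjmin : ∀ k, i ≤ k → k < Nat.find hexj → ¬ LeavesAt f x L k := fun k hk hkj h =>
    Nat.find_min hexj hkj ⟨hk, h⟩
  generalize Nat.find hexj = j at hij hj hjr hjmin
  have hvis : ∀ s, ∃ t, f^[t] (x L) = f^[s] (x i) := by
    intro s
    refine ⟨s + (t + 1 + tr), ?_⟩
    rw [Function.iterate_add_apply, Function.iterate_add_apply, htr,
      Function.iterate_succ_apply, hit]
  have hseg : ∀ s, i + s ≤ j → f^[s] (x i) = x (i + s) := by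
    intro s
    induction s with
    | zero => intro _; rfl
    | succ s ih =>
      intro hs
      have h1 := ih (by omega)
      rw [Function.iterate_succ_apply', h1]
      by_contra hc
      refine hjmin (i + s) (by omega) (by omega) ⟨by omega, ?_, fun h => hc h.2⟩
      rw [← h1]
      exact hvis s
  have hsegj : f^[j - i] (x i) = x j := by
    rw [hseg _ (by omega), show i + (j - i) = j by omega]
  -- If `j = r`, the walk would come back to `x r`, although `d` decreases strictly until `x 0`.
  have hjr' : j < r := by
    refine lt_of_le_of_ne hjr ?_
    rintro rfl
    have h1 : f^[j - i + (t + 1)] (x j) = x j := by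
      rw [Function.iterate_add_apply, Function.iterate_succ_apply, hit, hsegj]
    have h2 := iterate_lt hf0 hf (t := j - i + (t + 1)) (by omega) hrU hrx0
    rw [h1] at h2
    exact lt_irrefl _ h2
  -- If `x k` is visited before `x r`, the walk later moves forward from `k` to `r`, so it does not
  -- leave the path at `k`. If it is visited after, it comes after the stretch from `x i` to `x j`,
  -- so the walk moves forward from `j` to `k` and does not leave at `j`.
  have huniq : ∀ k, j < k → k < r → ¬ LeavesAt f x L k := by
    intro k hjk hkr hk
    obtain ⟨tk, htk⟩ := hk.2.1
    by_cases hle : tk ≤ tr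
    · obtain ⟨s, rfl⟩ := Nat.exists_eq_add_of_le' hle
      rw [Function.iterate_add_apply, htk] at htr
      have hs : 0 < s := by
        rcases Nat.eq_zero_or_pos s with rfl | hs
        · have := hinj k r hk.1 hrL htr
          omega
        · exact hs
      exact hk.2.2 (halong k r s hkr.le hrL hr0 hs htr)
    · obtain ⟨s, rfl⟩ := Nat.exists_eq_add_of_lt (not_le.1 hle)
      rw [show tr + s + 1 = s + 1 + tr by omega, Function.iterate_add_apply, htr,
        Function.iterate_succ_apply] at htk
      have hts : t ≤ s := by
        by_contra! hc
        exact hmin s hc k hk.1 htk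
      obtain ⟨a, rfl⟩ := Nat.exists_eq_add_of_le' hts
      rw [Function.iterate_add_apply, hit] at htk
      by_cases haj : i + a < j
      · rw [hseg a haj.le] at htk
        have := hinj _ _ (by omega) hk.1 htk
        omega
      · obtain ⟨b, rfl⟩ : ∃ b, a = b + (j - i) := ⟨a - (j - i), by omega⟩
        rw [Function.iterate_add_apply, hsegj] at htk
        have hb : 0 < b := by
          rcases Nat.eq_zero_or_pos b with rfl | hb
          · have := hinj j k hj.1 hk.1 htk
            omega
          · exact hb
        exact hj.2.2 (halong j k b hjk.le hk.1 (by omega) hb htk)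
  have hc1 : Nat.count (LeavesAt f x L) j = Nat.count (LeavesAt f x L) i :=
    count_eq_of_forall_not _ hij hjmin
  refine ⟨i, j, t, hij, hjr', hj, hit, hmin, hc1, ?_⟩
  rw [count_eq_of_forall_not _ (show j + 1 ≤ r from hjr') fun k h1 h2 => huniq k h1 h2,
    Nat.count_succ, if_pos hj, hc1]

/-- A walk that leaves a path at `x r` and returns at `x i` closes a directed cycle. -/
theorem exists_cycle_of_return {D : MultiDigraph V E} {L : ℕ} {x : ℕ → V} {d : V → ℕ} {f : V → V}
    (hx : Set.InjOn x (Set.Iic L)) (hadj : ∀ i < L, D.Adj (x i) (x (i + 1)))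
    (hmem : ∀ i ≤ L, x i ∈ D.verts) (hf0 : f (x 0) = x 0)
    (hf : ∀ y ∈ D.verts, y ≠ x 0 → D.Adj y (f y) ∧ d (f y) < d y)
    {i r t : ℕ} (hir : i < r) (hrL : r ≤ L) (hit : f^[t] (f (x r)) = x i)
    (hmin : ∀ s < t, ∀ k ≤ L, f^[s] (f (x r)) ≠ x k) :
    ∃ m ≥ r - i, ∃ c : ℕ → V, Set.InjOn c (Set.Iio m) ∧
      (∀ k, k + 1 < m → D.Adj (c k) (c (k + 1))) ∧ D.Adj (c (m - 1)) (c 0) := by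
  have hinj : ∀ i j, i ≤ L → j ≤ L → x i = x j → i = j := fun i j hi hj h => hx hi hj h
  have hf' : ∀ y ∈ D.verts, y ≠ x 0 → f y ∈ D.verts ∧ d (f y) < d y := fun y hy hy0 =>
    ⟨(hf y hy hy0).1.head_mem, (hf y hy hy0).2⟩
  have hoff : ∀ s, 0 < s → s ≤ t → ∀ k ≤ L, f^[s] (x r) ≠ x k := by
    intro s hs hst k hk
    obtain ⟨s, rfl⟩ : ∃ a, s = a + 1 := ⟨s - 1, by omega⟩
    exact hmin s (by omega) k hk
  have hne0 : ∀ s ≤ t, f^[s] (x r) ≠ x 0 := by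
    intro s hs
    rcases Nat.eq_zero_or_pos s with rfl | hs0
    · intro h
      have := hinj r 0 hrL (by omega) h
      omega
    · exact hoff s hs0 hs 0 (by omega)
  have hfD : ∀ s, f^[s] (x r) ∈ D.verts := fun s =>
    (iterate_mem_and_le hf0 hf' s _ (hmem r hrL)).1
  have hstep : ∀ s ≤ t, D.Adj (f^[s] (x r)) (f^[s + 1] (x r)) := by
    intro s hs
    rw [Function.iterate_succ_apply']
    exact (hf _ (hfD s) (hne0 s hs)).1
  have hfinj : ∀ s s', s < s' → s' ≤ t → f^[s] (x r) ≠ f^[s'] (x r) := by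
    intro s s' hs hs' h
    obtain ⟨a, rfl⟩ := Nat.exists_eq_add_of_lt hs
    have := iterate_lt hf0 hf' (t := a + 1) (by omega) (hfD s) (hne0 s (by omega))
    rw [← Function.iterate_add_apply, show a + 1 + s = s + a + 1 by omega, ← h] at this
    exact lt_irrefl _ this
  -- The cycle runs along the path from `x i` to `x r`, then along the walk, which avoids the path
  -- until it returns to `x i`.
  let c : ℕ → V := fun k => if k ≤ r - i then x (i + k) else f^[k - (r - i)] (x r)
  have hc1 : ∀ k ≤ r - i, c k = x (i + k) := fun k hk => if_pos hk
  have hc2 : ∀ k, r - i ≤ k → c k = f^[k - (r - i)] (x r) := by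
    intro k hk
    by_cases h : k ≤ r - i
    · rw [hc1 k h, show i + k = r by omega, show k - (r - i) = 0 by omega]
      rfl
    · exact if_neg h
  have hcne : ∀ k k', k < k' → k' < r - i + t + 1 → c k ≠ c k' := by
    intro k k' hkk hk' h
    by_cases h1 : k' ≤ r - i
    · rw [hc1 k (by omega), hc1 k' h1] at h
      have := hinj _ _ (by omega) (by omega) h
      omega
    · rw [hc2 k' (by omega)] at h
      by_cases h2 : k ≤ r - i
      · rw [hc1 k h2] at h
        exact hoff _ (by omega) (by omega) _ (by omega) h.symm
      · rw [hc2 k (by omega)] at h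
        exact hfinj _ _ (by omega) (by omega) h
  refine ⟨r - i + t + 1, by omega, c, ?_, ?_, ?_⟩
  · intro k hk k' hk' h
    rcases lt_trichotomy k k' with hlt | heq | hlt
    · exact absurd h (hcne k k' hlt hk')
    · exact heq
    · exact absurd h.symm (hcne k' k hlt hk)
  · intro k hk
    by_cases h : k < r - i
    · rw [hc1 k h.le, hc1 (k + 1) h]
      exact hadj _ (by omega)
    · rw [hc2 k (by omega), hc2 (k + 1) (by omega),
        show k + 1 - (r - i) = k - (r - i) + 1 by omega]
      exact hstep _ (by omega)
  · have := hstep t le_rfl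
    rw [Function.iterate_succ_apply, hit] at this
    rw [hc2 _ (by omega), hc1 0 (by omega), show r - i + t + 1 - 1 - (r - i) = t by omega]
    exact this

/-! ### The bidirected path -/

/-- `Nat.count p i` is the number of leaving points of index less than `i`, hence the number of the
path segment containing `x i`. The root of a segment is its last vertex, a leaving point: its next
path edge enters the following segment, and its walk edge leads to the preceding one. Vertices of
the walk off the path join the segment that they reach first. -/
theorem path_isButterflyMinor {D : MultiDigraph V E} (hD : D.StronglyConnected) {n L : ℕ}
    (hn : 1 ≤ n) (hL : n * n ≤ L) {x : ℕ → V} (hx : Set.InjOn x (Set.Iic L))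
    (hadj : ∀ i < L, D.Adj (x i) (x (i + 1)))
    (hcyc : ¬ ∃ m ≥ n, ∃ c : ℕ → V, Set.InjOn c (Set.Iio m) ∧
      (∀ k, k + 1 < m → D.Adj (c k) (c (k + 1))) ∧ D.Adj (c (m - 1)) (c 0)) :
    (ofSimpleGraph (SimpleGraph.pathGraph (n + 1))).IsButterflyMinor D := by
  classical
  have hinj : ∀ i j, i ≤ L → j ≤ L → x i = x j → i = j := fun i j hi hj h => hx hi hj h
  have hL0 : 0 < L := lt_of_lt_of_le (Nat.mul_pos hn hn) hL
  have hmem : ∀ i ≤ L, x i ∈ D.verts := by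
    intro i hi
    rcases Nat.lt_or_ge i L with h | h
    · exact (hadj i h).tail_mem
    · have := (hadj (i - 1) (by omega)).head_mem
      rwa [show i - 1 + 1 = i by omega] at this
  obtain ⟨d, f, hf0, hf, halong⟩ := exists_backward_walks hD hx hadj hmem
  have hf' : ∀ y ∈ D.verts, y ≠ x 0 → f y ∈ D.verts ∧ d (f y) < d y := fun y hy hy0 =>
    ⟨(hf y hy hy0).1.head_mem, (hf y hy hy0).2⟩
  have hret := fun r (hr : LeavesAt f x L r) (hr0 : 0 < r) =>
    hr.exists_return hx hmem hf0 hf' halong hr0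
  set p := LeavesAt f x L
  have hpL : p L := ⟨le_rfl, ⟨0, rfl⟩, fun h => lt_irrefl _ h.1⟩
  -- Each return spans fewer than `n` path edges and lands at or before the preceding leaving point
  -- `j`, so consecutive leaving points are less than `n` apart.
  have hcount : ∀ r, p r → r ≤ n * Nat.count p r := by
    intro r
    induction r using Nat.strong_induction_on with
    | _ r ih =>
      intro hr
      rcases Nat.eq_zero_or_pos r with rfl | hr0
      · exact Nat.zero_le _
      · obtain ⟨i, j, t, hij, hjr, hj, hit, hmin, hci, hcr⟩ := hret r hr hr0
        have h1 := ih j hjr hj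
        obtain ⟨m, hm, c, hc⟩ := exists_cycle_of_return hx hadj hmem hf0 hf
          (lt_of_le_of_lt hij hjr) hr.1 hit hmin
        have h2 : r - i < n := by
          by_contra! h
          exact hcyc ⟨m, h.trans hm, c, hc⟩
        rw [hcr, Nat.mul_add, ← hci]
        omega
  have hnL : n ≤ Nat.count p L := Nat.le_of_mul_le_mul_left (hL.trans (hcount L hpL)) hn
  have hroot : ∀ w : Fin (n + 1), ∃ i, p i ∧ Nat.count p i = w := by
    intro w
    obtain ⟨i, -, h⟩ := exists_count_eq p (L + 1) w (by
      rw [Nat.count_succ, if_pos hpL]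
      omega)
    exact ⟨i, h⟩
  choose ρ hρp hρc using hroot
  -- `idx y` is the index of the first path vertex on the walk from `y`
  let idx : V → ℕ := fun y =>
    Function.invFunOn x (Set.Iic L) (f^[sInf {t | ∃ i ≤ L, f^[t] y = x i}] y)
  have hidx : ∀ y t i, i ≤ L → f^[t] y = x i → (∀ s < t, ∀ k ≤ L, f^[s] y ≠ x k) →
      idx y = i := by
    intro y t i hi hit hmin
    have : sInf {t | ∃ i ≤ L, f^[t] y = x i} = t := by
      refine IsLeast.csInf_eq ⟨⟨i, hi, hit⟩, ?_⟩
      rintro s ⟨k, hk, hs⟩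
      by_contra! hst
      exact hmin s hst k hk hs
    simp only [idx, this, hit]
    exact hx.leftInvOn_invFunOn hi
  have hidxx : ∀ i ≤ L, idx (x i) = i := fun i hi =>
    hidx (x i) 0 i hi rfl fun s hs => absurd hs (Nat.not_lt_zero s)
  have hidxf : ∀ y ∈ D.verts, (∀ i ≤ L, y ≠ x i) → idx (f y) = idx y := by
    intro y hy hoff
    have hex : ∃ t, ∃ i ≤ L, f^[t] (f y) = x i :=
      ⟨_, 0, by omega, iterate_eventually hf0 hf' _ _ (hf' _ hy (hoff 0 (by omega))).1 le_rfl⟩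
    obtain ⟨i, hiL, hit⟩ := Nat.find_spec hex
    have hmin : ∀ s < Nat.find hex, ∀ k ≤ L, f^[s] (f y) ≠ x k := fun s hs k hk h =>
      Nat.find_min hex hs ⟨k, hk, h⟩
    rw [hidx (f y) _ i hiL hit hmin]
    refine (hidx y (Nat.find hex + 1) i hiL hit ?_).symm
    intro s hs k hk
    cases s with
    | zero => exact hoff k hk
    | succ s => exact hmin s (by omega) k hk
  let cnt : V → ℕ := fun y => Nat.count p (idx y)
  have hcntx : ∀ i ≤ L, cnt (x i) = Nat.count p i := fun i hi => by simp only [cnt, hidxx i hi]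
  let ψ : V → Fin (n + 1) := fun y => ⟨min (cnt y) n, by omega⟩
  have hψ : ∀ y (w : Fin (n + 1)), cnt y = w → ψ y = w := fun y w h =>
    Fin.ext (by change min (cnt y) n = w; omega)
  -- Only the first `n + 1` segments are kept, so the truncation in `ψ` has no effect on `X`.
  let X : Set V := {y | ((∃ i ≤ L, x i = y) ∨ ∃ t, f^[t] (x L) = y) ∧ cnt y ≤ n}
  have hXfin : X.Finite := by
    have : X ⊆ x '' Set.Iic L ∪ (fun t => f^[t] (x L)) '' Set.Iic (d (x L)) := by
      rintro y ⟨⟨i, hi, rfl⟩ | ⟨t, rfl⟩, -⟩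
      · exact .inl ⟨i, hi, rfl⟩
      · by_cases ht : t ≤ d (x L)
        · exact .inr ⟨t, ht, rfl⟩
        · refine .inl ⟨0, Nat.zero_le L, ?_⟩
          exact (iterate_eventually hf0 hf' t _ (hmem L le_rfl) (by omega)).symm
    exact (((Set.finite_Iic L).image _).union ((Set.finite_Iic _).image _)).subset this
  have hXD : X ⊆ D.verts := by
    rintro y ⟨⟨i, hi, rfl⟩ | ⟨t, rfl⟩, -⟩
    · exact hmem i hi
    · exact (iterate_mem_and_le hf0 hf' t _ (hmem L le_rfl)).1
  -- Path vertices move forward along the path to their root and vertices off the path follow `f`.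
  -- The offset `L + 1` puts every vertex off the path above all path vertices.
  refine isButterflyMinor_of_inTrees rfl rfl (ofSimpleGraph_ext _) hXfin hXD ψ
    (fun w => x (ρ w)) (fun y => if ∃ i ≤ L, x i = y then L - idx y else L + 1 + d y) ?_ ?_ ?_ ?_
  · intro w
    refine ⟨.inl ⟨ρ w, (hρp w).1, rfl⟩, ?_⟩
    rw [hcntx _ (hρp w).1, hρc]
    omega
  · intro w
    apply hψ
    rw [hcntx _ (hρp w).1, hρc]
  · rintro y ⟨hy, hyn⟩ hyρ
    have hψ' : ∀ z, cnt z = cnt y → ψ z = ψ y := fun z hz => Fin.ext (by simp only [ψ, hz])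
    by_cases hyP : ∃ i ≤ L, x i = y
    · obtain ⟨i, hi, rfl⟩ := hyP
      have hpi : ¬ p i := by
        intro hpi
        apply hyρ
        congr 1
        refine Nat.count_injective hpi (hρp _) ?_
        rw [hρc]
        change _ = min (cnt (x i)) n
        rw [Nat.min_eq_left hyn, hcntx i hi]
      have hiL : i < L := lt_of_le_of_ne hi fun h => hpi (h ▸ hpL)
      have hc : cnt (x (i + 1)) = cnt (x i) := by
        rw [hcntx i hi, hcntx (i + 1) hiL, Nat.count_succ, if_neg hpi, Nat.add_zero]
      refine ⟨x (i + 1), ⟨.inl ⟨i + 1, hiL, rfl⟩, hc.trans_le hyn⟩, hadj i hiL, hψ' _ hc, ?_⟩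
      rw [if_pos ⟨i + 1, hiL, rfl⟩, if_pos ⟨i, hi, rfl⟩, hidxx i hi, hidxx (i + 1) hiL]
      omega
    · have hyD := hXD ⟨hy, hyn⟩
      have hoff : ∀ i ≤ L, y ≠ x i := fun i hi h => hyP ⟨i, hi, h.symm⟩
      obtain ⟨h1, h2⟩ := hf y hyD (hoff 0 (by omega))
      have hc : cnt (f y) = cnt y := by simp only [cnt, hidxf y hyD hoff]
      refine ⟨f y, ⟨?_, hc.trans_le hyn⟩, h1, hψ' _ hc, ?_⟩
      · obtain ⟨t, rfl⟩ := hy.resolve_left hyP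
        exact .inr ⟨t + 1, Function.iterate_succ_apply' f t _⟩
      · rw [if_neg hyP]
        split_ifs <;> omega
  · intro e
    have hab := SimpleGraph.pathGraph_adj.1 e.adj
    change ∃ y ∈ X, D.Adj (x (ρ e.fst)) y ∧ ψ y = e.snd
    generalize e.fst = a at *
    generalize e.snd = b at *
    have hb := b.2
    have haL := (hρp a).1
    rcases hab with hab | hab
    · have hlt : ρ a < L := by
        refine lt_of_le_of_ne haL fun h => ?_
        have := hρc a
        rw [h] at this
        omega
      have hc : cnt (x (ρ a + 1)) = b := by
        rw [hcntx _ hlt, Nat.count_succ, if_pos (hρp a), hρc, hab]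
      exact ⟨x (ρ a + 1), ⟨.inl ⟨_, hlt, rfl⟩, by omega⟩, hadj _ hlt, hψ _ _ hc⟩
    · have hpos : 0 < ρ a := by
        by_contra h
        have := hρc a
        rw [show ρ a = 0 by omega, Nat.count_zero] at this
        omega
      -- The backward edge is the first edge of the walk after the leaving point: its head belongs
      -- to the segment of the return point, whose count is one less.
      obtain ⟨i, j, t, hij, hjr, -, hit, hmin, -, hcr⟩ := hret _ (hρp a) hpos
      have hne : x (ρ a) ≠ x 0 := fun h => by
        have := hinj _ _ haL (by omega) h
        omega
      have hc : cnt (f (x (ρ a))) = b := by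
        have h1 : idx (f (x (ρ a))) = i := hidx _ t i (by omega) hit hmin
        have h2 := hρc a
        simp only [cnt, h1]
        omega
      obtain ⟨s, hs⟩ := (hρp a).2.1
      refine ⟨f (x (ρ a)), ⟨.inr ⟨s + 1, ?_⟩, by omega⟩, (hf _ (hmem _ haL) hne).1, hψ _ _ hc⟩
      rw [Function.iterate_succ_apply', hs]

end MultiDigraph

/-! ### The three cases -/

theorem mainTheorem2 :
    ∃ g : ℕ → ℕ, ∀ (n : ℕ) (V : Type*) (E : Type*) (D : MultiDigraph V E),
      D.StronglyConnected → (g n : ℕ∞) ≤ D.verts.encard →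
        (MultiDigraph.ofSimpleGraph
          (completeBipartiteGraph (Fin 1) (Fin n))).IsButterflyMinor D ∨
        (MultiDigraph.ofSimpleGraph (SimpleGraph.pathGraph (n + 1))).IsButterflyMinor D ∨
        (1 ≤ n ∧ (MultiDigraph.directedCycle n).IsButterflyMinor D) := by
  -- The outer power is for the out-tree and the inner one for the in-tree, both of depth at most `n
  -- * n`. For `n = 0` the value is 2, and one vertex already gives the path without edges.
  refine ⟨fun n => (n ^ (n * n) + 1) ^ (n * n) + 1, fun n V E D hD hcard => ?_⟩
  rcases Nat.eq_zero_or_pos n with rfl | hn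
  · refine .inr (.inl ?_)
    have hne : D.verts.Nonempty := by
      rw [← Set.one_le_encard_iff_nonempty]
      refine le_trans ?_ hcard
      norm_num
    exact MultiDigraph.ofSimpleGraph_isButterflyMinor_of_subsingleton (W := Fin 1) _ hne
  · by_cases hcyc : ∃ m ≥ n, ∃ c : ℕ → V, Set.InjOn c (Set.Iio m) ∧
      (∀ k, k + 1 < m → D.Adj (c k) (c (k + 1))) ∧ D.Adj (c (m - 1)) (c 0)
    · obtain ⟨m, hm, c, hc, hadj, hlast⟩ := hcyc
      exact .inr (.inr ⟨hn, MultiDigraph.directedCycle_isButterflyMinor hn hm c hc hadj hlast⟩)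
    · by_cases hpath : ∃ x : ℕ → V, Set.InjOn x (Set.Iic (n * n)) ∧
        ∀ i < n * n, D.Adj (x i) (x (i + 1))
      · obtain ⟨x, hx, hadj⟩ := hpath
        exact .inr (.inl (MultiDigraph.path_isButterflyMinor hD hn le_rfl hx hadj hcyc))
      · exact .inl (MultiDigraph.star_isButterflyMinor hD hpath hcard)
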